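/- Let $L_0, L_1, L_2, \dots$ be the polynomials obtained by applying the Gram–Schmidt orthonormalization in $L^2([0,1])$ to $1, x, x^2, \dots$. For a compact convex set $A \subset [0,1]^2$ let $\lambda_{kl}(A) = \int_A L_k(x_1) L_l(x_2)\, d(x_1,x_2)$, $k,l \ge 0$, be its Legendre moments, and let the Nikodym distance $\delta_N(A,B)$ of two such sets be the area of $(A\setminus B)\cup(B\setminus A)$. For $0 \le \vartheta_1 < \dots < \vartheta_n < 2\pi$ put $u_i = (\cos\vartheta_i, \sin\vartheta_i)$ and $P(h_1,\dots,h_n) = \bigcap_{i=1}^n \{x \in \mathbb{R}^2 : \langle x,u_i\rangle \le h_i\}$ for $h \in \mathbb{R}^n$. Let $\mathcal{P}(\vartheta_1,\dots,\vartheta_n)$ be the set of all $P(h_1,\dots,h_n) \subset [0,1]^2$ for which $\sup\{\langle x,u_i\rangle : x\in P(h_1,\dots,h_n)\} = h_i$ for $i=1,\dots,n$. For a compact convex set $K\subset[0,1]^2$ and $N \ge 0$, a least squares estimator of $K$ with respect to the first $(N+1)^2$ Legendre moments on $\mathcal{P}(\vartheta_1,\dots,\vartheta_n)$ is any $\hat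 P \in \mathcal{P}(\vartheta_1,\dots,\vartheta_n)$ that minimizes $\sum_{k,l=0}^N (\lambda_{kl}(K)-\lambda_{kl}(P))^2$ over $P \in \mathcal{P}(\vartheta_1,\dots,\vartheta_n)$. Let $K\subset[0,1]^2$ be a convex body, that is, a compact convex set with nonempty interior, and let $(\theta_i)_{i\ge1}$ be a dense sequence in $[0,2\pi)$ with $\theta_i\ne\theta_j$ for $i\ne j$ and $(\theta_1,\theta_2,\theta_3,\theta_4) = (0,\frac{\pi}{2},\pi,\frac{3\pi}{2})$. For each $n$ let $\theta_{(1)} < \dots < \theta_{(n)}$ be $\theta_1,\dots,\theta_n$ arranged in increasing order. For all $n\ge4$ and $N\ge1$, let $\hat P_{n,N}$ be a least squares estimator of $K$ with respect to the first $(N+1)^2$ Legendre moments on $\mathcal{P}(\theta_{(1)},\dots,\theta_{(n)})$. Then $$\delta_N(K,\hat P_{n,N}) \to 0 \quad\text{as } n,N\to\infty,$$ that is, for every $\varepsilon>0$ there is $m$ such that $\delta_N(K,\hat P_{n,N}) < \varepsilon$ for all $n,N\ge m$. -/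

import Mathlib

open Set Filter Topology MeasureTheory
open scoped Polynomial symmDiff

namespace MomentReconstruction

noncomputable section

/-- The `L²([0,1])` inner product of two real polynomials. -/
def polyInner (p q : ℝ[X]) : ℝ :=
  ∫ x in (0 : ℝ)..1, p.eval x * q.eval x

/-- The shifted and normalized Legendre polynomials: the Gram-Schmidt orthonormalization of
`1, x, x², …` in `L²([0,1])`. -/
def legendrePoly (n : ℕ) : ℝ[X] :=
  let v : ℝ[X] := Polynomial.X ^ n -
    ∑ i : Fin n, Polynomial.C (polyInner (legendrePoly i) (Polynomial.X ^ n)) * legendrePoly i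
  Polynomial.C (Real.sqrt (polyInner v v))⁻¹ * v
termination_by n
decreasing_by all_goals exact i.isLt

/-- The unit square `[0,1]²`. The plane is modelled as `ℝ × ℝ`; only its vector space structure,
its topology and its Lebesgue measure are used, and inner products are written out. -/
def unitSquare : Set (ℝ × ℝ) := Icc (0 : ℝ) 1 ×ˢ Icc (0 : ℝ) 1

/-- A planar convex body: a compact convex set with nonempty interior. -/
structure IsConvexBody (K : Set (ℝ × ℝ)) : Prop where
  isCompact : IsCompact K
  convex : Convex ℝ K
  interior_nonempty : (interior K).Nonempty

/-- The Legendre moment `λ_{ij}(K) = ∫_K L_i(x₁) L_j(x₂) d(x₁,x₂)`. -/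
def legendreMoment (i j : ℕ) (K : Set (ℝ × ℝ)) : ℝ :=
  ∫ x in K, (legendrePoly i).eval x.1 * (legendrePoly j).eval x.2

/-- The Nikodym distance: the area of the symmetric difference. -/
def nikodymDist (K L : Set (ℝ × ℝ)) : ℝ := volume.real (K ∆ L)

/-- The inner product `⟨x, u_t⟩` of `x` with the unit vector `u_t = (cos t, sin t)`. -/
def innerDir (t : ℝ) (x : ℝ × ℝ) : ℝ := x.1 * Real.cos t + x.2 * Real.sin t

/-- `P(h₁, …, hₙ)`: the intersection of the half-planes `{x | ⟨x, u_i⟩ ≤ h_i}`. -/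
def polygon {n : ℕ} (θ h : Fin n → ℝ) : Set (ℝ × ℝ) :=
  {x | ∀ i, innerDir (θ i) x ≤ h i}

/-- `h` is consistent with respect to `θ`: for every `i`, the support function of
`P(h₁, …, hₙ)` in the direction `u_i`, that is `sup {⟨x, u_i⟩ | x ∈ P(h₁, …, hₙ)}`, equals `h_i`.
(If `n ≥ 1`, this forces `P(h₁, …, hₙ)` to be nonempty, as the empty set has no real supremum.) -/
def Consistent {n : ℕ} (θ h : Fin n → ℝ) : Prop :=
  ∀ i, IsLUB (innerDir (θ i) '' polygon θ h) (h i)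

/-- `𝒫(θ₁, …, θₙ)`: the polygons `P(h₁, …, hₙ) ⊆ [0,1]²` with `h` consistent. -/
def polygonClass {n : ℕ} (θ : Fin n → ℝ) : Set (Set (ℝ × ℝ)) :=
  {P | ∃ h : Fin n → ℝ, Consistent θ h ∧ P = polygon θ h ∧ P ⊆ unitSquare}

/-- The sum of squared differences of the first `(N+1)²` Legendre moments of `K` and `P`. -/
def legendreDiscrepancy (N : ℕ) (K P : Set (ℝ × ℝ)) : ℝ :=
  ∑ k ∈ Finset.range (N + 1), ∑ l ∈ Finset.range (N + 1),
    (legendreMoment k l K - legendreMoment k l P) ^ 2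

/-- `P` is a least squares estimator of `K` with respect to the first `(N+1)²` Legendre moments on
the space `𝒫(θ₁, …, θₙ)`. -/
def IsLeastSquaresEstimator {n : ℕ} (θ : Fin n → ℝ) (N : ℕ) (K P : Set (ℝ × ℝ)) : Prop :=
  P ∈ polygonClass θ ∧ IsMinOn (legendreDiscrepancy N K) (polygonClass θ) P

/-- `(θ_(1), …, θ_(n))`: the first `n` terms of the sequence `θ` in increasing order. -/
def sortedAngles (θ : ℕ → ℝ) (n : ℕ) : Fin n → ℝ :=
  (fun i : Fin n => θ i) ∘ Tuple.sort (fun i : Fin n => θ i)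

end

end MomentReconstruction

namespace MomentReconstruction

/-! Let `C_n` be the polygon circumscribed to `K` with the first `n` normals. It competes in the
least squares problem (`circumscribed_mem_polygonClass`), and by Bessel's inequality its discrepancy
is at most its Nikodym distance to `K` for every `N` (`legendreDiscrepancy_le_nikodymDist`). Density
of the angles sends this distance to 0 (`tendsto_nikodymDist_circumscribed`), so the discrepancy of
the estimator is small for large `n`, uniformly in `N`.

Conversely, small discrepancy forces small distance (`exists_nikodymDist_lt`). The distance is
linear in the indicator of `P`: it equals `∫ (1_K - 1_P) g` with `g = 2·1_K - 1` independent of `P`.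
Replacing `g` by an `L¹`-close polynomial costs little because `|1_K - 1_P| ≤ 1`, and the polynomial
integral involves only finitely many moments. No convexity of `P` is needed here. -/

/-! ### Legendre polynomials: orthonormality and span -/

theorem polyInner_comm (p q : ℝ[X]) : polyInner p q = polyInner q p := by
  simp only [polyInner, mul_comm]

theorem intervalIntegrable_eval_mul (p q : ℝ[X]) :
    IntervalIntegrable (fun x => p.eval x * q.eval x) volume 0 1 :=
  (p.continuous.mul q.continuous).intervalIntegrable _ _

theorem polyInner_C_mul_left (a : ℝ) (p q : ℝ[X]) :
    polyInner (Polynomial.C a * p) q = a * polyInner p q := by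
  simp only [polyInner, Polynomial.eval_mul, Polynomial.eval_C, mul_assoc,
    intervalIntegral.integral_const_mul]

theorem polyInner_sub_left (p q r : ℝ[X]) :
    polyInner (p - q) r = polyInner p r - polyInner q r := by
  simp only [polyInner, Polynomial.eval_sub, sub_mul]
  exact intervalIntegral.integral_sub (intervalIntegrable_eval_mul p r)
    (intervalIntegrable_eval_mul q r)

theorem polyInner_sum_left {ι : Type*} (s : Finset ι) (f : ι → ℝ[X]) (r : ℝ[X]) :
    polyInner (∑ i ∈ s, f i) r = ∑ i ∈ s, polyInner (f i) r := by
  simp only [polyInner, Polynomial.eval_finsetSum, Finset.sum_mul]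
  exact intervalIntegral.integral_finsetSum fun i _ => intervalIntegrable_eval_mul (f i) r

theorem polyInner_self_pos {p : ℝ[X]} (hp : p ≠ 0) : 0 < polyInner p p := by
  refine intervalIntegral.integral_pos one_pos (p.continuous.mul p.continuous).continuousOn
    (fun x _ => mul_self_nonneg _) ?_
  by_contra! h
  refine hp (p.eq_zero_of_infinite_isRoot ((Icc_infinite (zero_lt_one' ℝ)).mono fun x hx => ?_))
  exact mul_self_eq_zero.1 (le_antisymm (h x hx) (mul_self_nonneg _))

/-- The component of `X ^ n` orthogonal to the Legendre polynomials of smaller index. -/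
noncomputable def legendreResidual (n : ℕ) : ℝ[X] :=
  Polynomial.X ^ n - ∑ i ∈ Finset.range n,
    Polynomial.C (polyInner (legendrePoly i) (Polynomial.X ^ n)) * legendrePoly i

theorem legendrePoly_eq (n : ℕ) :
    legendrePoly n =
      Polynomial.C (Real.sqrt (polyInner (legendreResidual n) (legendreResidual n)))⁻¹ *
        legendreResidual n := by
  rw [legendrePoly, legendreResidual, Finset.sum_range]

/-- This degree bound leaves the coefficient of `X ^ n` in `legendreResidual n` equal to 1, so the
normalization never divides by zero. -/
theorem legendrePoly_coeff_eq_zero (n m : ℕ) (h : n < m) : (legendrePoly n).coeff m = 0 := by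
  induction n using Nat.strong_induction_on with
  | _ n ih =>
    have hsum : ∀ i ∈ Finset.range n, (Polynomial.C (polyInner (legendrePoly i)
        (Polynomial.X ^ n)) * legendrePoly i).coeff m = 0 := fun i hi => by
      have hi := Finset.mem_range.1 hi
      rw [Polynomial.coeff_C_mul, ih i hi (hi.trans h), mul_zero]
    rw [legendrePoly_eq, Polynomial.coeff_C_mul, legendreResidual, Polynomial.coeff_sub,
      Polynomial.finsetSum_coeff, Finset.sum_eq_zero hsum, Polynomial.coeff_X_pow, if_neg h.ne',
      sub_zero, mul_zero]

theorem legendreResidual_ne_zero (n : ℕ) : legendreResidual n ≠ 0 := by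
  intro h
  have h1 : (legendreResidual n).coeff n = 1 := by
    rw [legendreResidual, Polynomial.coeff_sub, Polynomial.finsetSum_coeff, Finset.sum_eq_zero,
      Polynomial.coeff_X_pow_self, sub_zero]
    intro i hi
    rw [Polynomial.coeff_C_mul, legendrePoly_coeff_eq_zero i n (Finset.mem_range.1 hi), mul_zero]
  simp [h] at h1

theorem sqrt_polyInner_legendreResidual_pos (n : ℕ) :
    0 < Real.sqrt (polyInner (legendreResidual n) (legendreResidual n)) :=
  Real.sqrt_pos.2 (polyInner_self_pos (legendreResidual_ne_zero n))

theorem polyInner_legendrePoly_self (n : ℕ) : polyInner (legendrePoly n) (legendrePoly n) = 1 := by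
  have h := sqrt_polyInner_legendreResidual_pos n
  have h2 := Real.mul_self_sqrt (polyInner_self_pos (legendreResidual_ne_zero n)).le
  rw [legendrePoly_eq, polyInner_C_mul_left, polyInner_comm (legendreResidual n) (_ * _),
    polyInner_C_mul_left]
  set s := Real.sqrt (polyInner (legendreResidual n) (legendreResidual n))
  rw [← h2]
  field_simp

theorem polyInner_legendrePoly_of_lt (n j : ℕ) (h : j < n) :
    polyInner (legendrePoly n) (legendrePoly j) = 0 := by
  induction n using Nat.strong_induction_on generalizing j with
  | _ n ih =>
    rw [legendrePoly_eq n, polyInner_C_mul_left]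
    refine mul_eq_zero_of_right _ ?_
    rw [legendreResidual, polyInner_sub_left, polyInner_sum_left, Finset.sum_eq_single j]
    · rw [polyInner_C_mul_left, polyInner_legendrePoly_self, polyInner_comm, mul_one, sub_self]
    · intro i hi hij
      rw [polyInner_C_mul_left]
      rcases lt_or_gt_of_ne hij with hlt | hlt
      · rw [polyInner_comm (legendrePoly i) (legendrePoly j), ih j h i hlt, mul_zero]
      · rw [ih i (Finset.mem_range.1 hi) j hlt, mul_zero]
    · intro hj
      exact absurd (Finset.mem_range.2 h) hj

theorem polyInner_legendrePoly (i j : ℕ) :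
    polyInner (legendrePoly i) (legendrePoly j) = if i = j then 1 else 0 := by
  split_ifs with h
  · rw [h, polyInner_legendrePoly_self]
  · rcases lt_or_gt_of_ne h with hlt | hlt
    · rw [polyInner_comm, polyInner_legendrePoly_of_lt j i hlt]
    · exact polyInner_legendrePoly_of_lt i j hlt

theorem X_pow_mem_span_legendrePoly (n : ℕ) :
    (Polynomial.X ^ n : ℝ[X]) ∈ Submodule.span ℝ (range legendrePoly) := by
  have h : (Polynomial.X ^ n : ℝ[X]) =
      Real.sqrt (polyInner (legendreResidual n) (legendreResidual n)) • legendrePoly n +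
        ∑ i ∈ Finset.range n, polyInner (legendrePoly i) (Polynomial.X ^ n) • legendrePoly i := by
    have hs := (sqrt_polyInner_legendreResidual_pos n).ne'
    rw [legendrePoly_eq n, ← Polynomial.smul_eq_C_mul, smul_smul, mul_inv_cancel₀ hs, one_smul, legendreResidual]
    simp only [Polynomial.smul_eq_C_mul, sub_add_cancel]
  rw [h]
  exact add_mem (Submodule.smul_mem _ _ (Submodule.subset_span ⟨n, rfl⟩))
    (sum_mem fun i _ => Submodule.smul_mem _ _ (Submodule.subset_span ⟨i, rfl⟩))

/-! ### Tensor products on the unit square and Bessel's inequality -/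

/-- The tensor product Legendre function `(x₁, x₂) ↦ L_k(x₁) L_l(x₂)`. -/
noncomputable def legendreFun (i : ℕ × ℕ) (x : ℝ × ℝ) : ℝ :=
  (legendrePoly i.1).eval x.1 * (legendrePoly i.2).eval x.2

theorem continuous_legendreFun (i : ℕ × ℕ) : Continuous (legendreFun i) :=
  ((legendrePoly i.1).continuous.comp continuous_fst).mul
    ((legendrePoly i.2).continuous.comp continuous_snd)

theorem isCompact_unitSquare : IsCompact unitSquare := isCompact_Icc.prod isCompact_Icc

theorem measurableSet_unitSquare : MeasurableSet unitSquare :=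
  isCompact_unitSquare.measurableSet

theorem volume_unitSquare_ne_top : volume unitSquare ≠ ⊤ := isCompact_unitSquare.measure_lt_top.ne

theorem integral_legendreFun_mul (i j : ℕ × ℕ) :
    ∫ x in unitSquare, legendreFun i x * legendreFun j x = if i = j then 1 else 0 := by
  have h : ∀ k l : ℕ, ∫ x in Icc (0 : ℝ) 1, (legendrePoly k).eval x * (legendrePoly l).eval x =
      if k = l then 1 else 0 := by
    intro k l
    rw [← polyInner_legendrePoly, polyInner, intervalIntegral.integral_of_le zero_le_one,
      integral_Icc_eq_integral_Ioc]
  have h2 : ∀ x : ℝ × ℝ, legendreFun i x * legendreFun j x =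
      ((legendrePoly i.1).eval x.1 * (legendrePoly j.1).eval x.1) *
        ((legendrePoly i.2).eval x.2 * (legendrePoly j.2).eval x.2) := fun x => by
    simp only [legendreFun]; ring
  simp only [h2]
  rw [unitSquare, Measure.volume_eq_prod, setIntegral_prod_mul
    (fun x => (legendrePoly i.1).eval x * (legendrePoly j.1).eval x)
    (fun x => (legendrePoly i.2).eval x * (legendrePoly j.2).eval x), h, h]
  by_cases h1 : i.1 = j.1 <;> by_cases h2 : i.2 = j.2 <;> simp [Prod.ext_iff, h1, h2]

/-- **Bessel's inequality** for a finite orthonormal system of functions. -/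
theorem sum_sq_integral_mul_le {α ι : Type*} [DecidableEq ι] [MeasurableSpace α] {μ : Measure α}
    (s : Finset ι) (e : ι → α → ℝ) (f : α → ℝ)
    (hee : ∀ i j, Integrable (fun x => e i x * e j x) μ)
    (hfe : ∀ i, Integrable (fun x => f x * e i x) μ) (hff : Integrable (fun x => f x ^ 2) μ)
    (he : ∀ i j, ∫ x, e i x * e j x ∂μ = if i = j then 1 else 0) :
    ∑ i ∈ s, (∫ x, f x * e i x ∂μ) ^ 2 ≤ ∫ x, f x ^ 2 ∂μ := by
  set c : ι → ℝ := fun i => ∫ x, f x * e i x ∂μ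
  have h1 : Integrable (fun x => ∑ i ∈ s, 2 * c i * (f x * e i x)) μ :=
    integrable_finsetSum _ fun i _ => (hfe i).const_mul _
  have h2 : Integrable (fun x => ∑ i ∈ s, ∑ j ∈ s, c i * c j * (e i x * e j x)) μ :=
    integrable_finsetSum _ fun i _ => integrable_finsetSum _ fun j _ => (hee i j).const_mul _
  have hexp : ∀ x, (f x - ∑ i ∈ s, c i * e i x) ^ 2 = f x ^ 2 - ∑ i ∈ s, 2 * c i * (f x * e i x) +
      ∑ i ∈ s, ∑ j ∈ s, c i * c j * (e i x * e j x) := by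
    intro x
    have ha : ∑ i ∈ s, 2 * c i * (f x * e i x) = 2 * f x * ∑ i ∈ s, c i * e i x := by
      rw [Finset.mul_sum]; exact Finset.sum_congr rfl fun i _ => by ring
    have hb : ∑ i ∈ s, ∑ j ∈ s, c i * c j * (e i x * e j x) = (∑ i ∈ s, c i * e i x) ^ 2 := by
      rw [sq, Finset.sum_mul_sum]
      exact Finset.sum_congr rfl fun i _ => Finset.sum_congr rfl fun j _ => by ring
    rw [ha, hb]; ring
  -- By orthonormality this integral is `∫ f² - 2 ∑ c_i² + ∑ c_i²`.
  have h0 : 0 ≤ ∫ x, (f x - ∑ i ∈ s, c i * e i x) ^ 2 ∂μ := integral_nonneg fun x => sq_nonneg _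
  simp only [hexp] at h0
  rw [integral_add (by exact hff.sub h1) h2, integral_sub hff h1,
    integral_finsetSum _ fun i _ => (hfe i).const_mul _,
    integral_finsetSum _ fun i _ => integrable_finsetSum _ fun j _ => (hee i j).const_mul _] at h0
  have h3 : ∑ i ∈ s, ∫ x, ∑ j ∈ s, c i * c j * (e i x * e j x) ∂μ = ∑ i ∈ s, c i ^ 2 := by
    refine Finset.sum_congr rfl fun i hi => ?_
    rw [integral_finsetSum _ fun j _ => (hee i j).const_mul _]
    simp only [integral_const_mul, he, mul_ite, mul_one, mul_zero, Finset.sum_ite_eq, if_pos hi, sq]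
  have h4 : ∑ i ∈ s, ∫ x, 2 * c i * (f x * e i x) ∂μ = 2 * ∑ i ∈ s, c i ^ 2 := by
    rw [Finset.mul_sum]
    refine Finset.sum_congr rfl fun i _ => ?_
    rw [integral_const_mul]
    ring
  rw [h3, h4] at h0
  linarith

/-! ### Moments and Nikodym distance as integrals of an indicator difference -/

/-- The difference of the indicator functions of `K` and `P`. -/
noncomputable def indicatorDiff (K P : Set (ℝ × ℝ)) (x : ℝ × ℝ) : ℝ :=
  K.indicator 1 x - P.indicator 1 x

theorem abs_indicatorDiff_le_one (K P : Set (ℝ × ℝ)) (x : ℝ × ℝ) : |indicatorDiff K P x| ≤ 1 := by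
  by_cases h1 : x ∈ K <;> by_cases h2 : x ∈ P <;> simp [indicatorDiff, h1, h2]

theorem measurable_indicatorDiff {K P : Set (ℝ × ℝ)} (hK : MeasurableSet K)
    (hP : MeasurableSet P) : Measurable (indicatorDiff K P) :=
  (measurable_one.indicator hK).sub (measurable_one.indicator hP)

theorem integrableOn_indicatorDiff_mul {K P : Set (ℝ × ℝ)} (hK : MeasurableSet K)
    (hP : MeasurableSet P) {g : ℝ × ℝ → ℝ} (hg : IntegrableOn g unitSquare) :
    IntegrableOn (fun x => indicatorDiff K P x * g x) unitSquare :=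
  Integrable.bdd_mul hg (measurable_indicatorDiff hK hP).aestronglyMeasurable
    (ae_of_all _ (abs_indicatorDiff_le_one K P))

theorem integral_indicator_one_mul {K : Set (ℝ × ℝ)} (hK : MeasurableSet K) (h : K ⊆ unitSquare)
    (g : ℝ × ℝ → ℝ) : ∫ x in unitSquare, K.indicator 1 x * g x = ∫ x in K, g x := by
  have : (fun x => K.indicator 1 x * g x) = K.indicator g := by
    ext x; by_cases hx : x ∈ K <;> simp [hx]
  rw [this, setIntegral_indicator hK, inter_eq_self_of_subset_right h]

theorem integral_indicatorDiff_mul {K P : Set (ℝ × ℝ)} (hK : MeasurableSet K)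
    (hP : MeasurableSet P) (hKs : K ⊆ unitSquare) (hPs : P ⊆ unitSquare)
    {g : ℝ × ℝ → ℝ} (hg : IntegrableOn g unitSquare) :
    ∫ x in unitSquare, indicatorDiff K P x * g x = (∫ x in K, g x) - ∫ x in P, g x := by
  have hint : ∀ A : Set (ℝ × ℝ), MeasurableSet A →
      IntegrableOn (fun x => A.indicator 1 x * g x) unitSquare := fun A hA =>
    Integrable.bdd_mul hg (measurable_one.indicator hA).aestronglyMeasurable (c := 1)
      (ae_of_all _ fun x => by by_cases hx : x ∈ A <;> simp [hx])
  simp only [indicatorDiff, sub_mul]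
  rw [integral_sub (hint K hK) (hint P hP)]
  congr 1
  · exact integral_indicator_one_mul hK hKs g
  · exact integral_indicator_one_mul hP hPs g

theorem integral_indicatorDiff_sq {K P : Set (ℝ × ℝ)} (hK : MeasurableSet K)
    (hP : MeasurableSet P) (hKs : K ⊆ unitSquare) (hPs : P ⊆ unitSquare) :
    ∫ x in unitSquare, indicatorDiff K P x ^ 2 = nikodymDist K P := by
  have h : (fun x => indicatorDiff K P x ^ 2) = (K ∆ P).indicator 1 := by
    ext x
    by_cases h1 : x ∈ K <;> by_cases h2 : x ∈ P <;> simp [indicatorDiff, mem_symmDiff, h1, h2]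
  have hm : MeasurableSet (K ∆ P) := hK.symmDiff hP
  have hs : K ∆ P ⊆ unitSquare := symmDiff_subset_union.trans (union_subset hKs hPs)
  rw [h, integral_indicator_one hm, nikodymDist, measureReal_restrict_apply hm,
    inter_eq_self_of_subset_left hs]

theorem legendreMoment_sub {K P : Set (ℝ × ℝ)} (hK : MeasurableSet K)
    (hP : MeasurableSet P) (hKs : K ⊆ unitSquare) (hPs : P ⊆ unitSquare) (i : ℕ × ℕ) :
    legendreMoment i.1 i.2 K - legendreMoment i.1 i.2 P =
      ∫ x in unitSquare, indicatorDiff K P x * legendreFun i x :=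
  (integral_indicatorDiff_mul hK hP hKs hPs
    ((continuous_legendreFun i).continuousOn.integrableOn_compact isCompact_unitSquare)).symm

theorem legendreDiscrepancy_eq (N : ℕ) (K P : Set (ℝ × ℝ)) : legendreDiscrepancy N K P =
    ∑ i ∈ Finset.range (N + 1) ×ˢ Finset.range (N + 1),
      (legendreMoment i.1 i.2 K - legendreMoment i.1 i.2 P) ^ 2 := by
  rw [legendreDiscrepancy, Finset.sum_product]

theorem legendreDiscrepancy_le_nikodymDist {K P : Set (ℝ × ℝ)} (hK : MeasurableSet K)
    (hP : MeasurableSet P) (hKs : K ⊆ unitSquare) (hPs : P ⊆ unitSquare) (N : ℕ) :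
    legendreDiscrepancy N K P ≤ nikodymDist K P := by
  have hL : ∀ i, IntegrableOn (legendreFun i) unitSquare := fun i =>
    (continuous_legendreFun i).continuousOn.integrableOn_compact isCompact_unitSquare
  have hone : IntegrableOn (fun _ => (1 : ℝ)) unitSquare :=
    continuousOn_const.integrableOn_compact isCompact_unitSquare
  rw [legendreDiscrepancy_eq, ← integral_indicatorDiff_sq hK hP hKs hPs]
  simp only [legendreMoment_sub hK hP hKs hPs]
  refine sum_sq_integral_mul_le _ _ _ (fun i j => ?_)
    (fun i => integrableOn_indicatorDiff_mul hK hP (hL i)) ?_ integral_legendreFun_mul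
  · exact ((continuous_legendreFun i).mul
      (continuous_legendreFun j)).continuousOn.integrableOn_compact isCompact_unitSquare
  · have := integrableOn_indicatorDiff_mul hK hP (integrableOn_indicatorDiff_mul hK hP hone)
    simp only [mul_one, ← sq] at this
    exact this

theorem abs_legendreMoment_sub_le {N : ℕ} {i : ℕ × ℕ} (h1 : i.1 ≤ N) (h2 : i.2 ≤ N)
    (K P : Set (ℝ × ℝ)) : |legendreMoment i.1 i.2 K - legendreMoment i.1 i.2 P| ≤
      Real.sqrt (legendreDiscrepancy N K P) := by
  rw [legendreDiscrepancy_eq]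
  refine Real.abs_le_sqrt (Finset.single_le_sum
    (f := fun i : ℕ × ℕ => (legendreMoment i.1 i.2 K - legendreMoment i.1 i.2 P) ^ 2)
    (fun _ _ => sq_nonneg _) ?_)
  simp only [Finset.mem_product, Finset.mem_range]
  omega

/-! ### Support functions and circumscribed polygons -/

theorem continuous_innerDir (t : ℝ) : Continuous (innerDir t) := by
  unfold innerDir; fun_prop

theorem bddAbove_innerDir_image {K : Set (ℝ × ℝ)} (hK : IsCompact K) (t : ℝ) :
    BddAbove (innerDir t '' K) :=
  (hK.image (continuous_innerDir t)).bddAbove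

theorem isClosed_polygon {n : ℕ} (θ h : Fin n → ℝ) : IsClosed (polygon θ h) := by
  simp only [polygon, ofPred_forall]
  exact isClosed_iInter fun i => isClosed_le (continuous_innerDir _) continuous_const

/-- The support function of `K` in the direction `(cos t, sin t)`. -/
noncomputable def supportFun (K : Set (ℝ × ℝ)) (t : ℝ) : ℝ := sSup (innerDir t '' K)

theorem innerDir_le_supportFun {K : Set (ℝ × ℝ)} (hK : IsCompact K) (t : ℝ) {x : ℝ × ℝ}
    (hx : x ∈ K) : innerDir t x ≤ supportFun K t :=
  le_csSup (bddAbove_innerDir_image hK t) (mem_image_of_mem _ hx)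

theorem supportFun_le {K : Set (ℝ × ℝ)} (hne : K.Nonempty) {t c : ℝ}
    (h : ∀ x ∈ K, innerDir t x ≤ c) : supportFun K t ≤ c :=
  csSup_le (hne.image _) (forall_mem_image.2 h)

/-- The polygon circumscribed to `K` with outer normal angles `θ 0, …, θ (n - 1)`. -/
def circumscribed (K : Set (ℝ × ℝ)) (θ : ℕ → ℝ) (n : ℕ) : Set (ℝ × ℝ) :=
  {x | ∀ i < n, innerDir (θ i) x ≤ supportFun K (θ i)}

theorem circumscribed_eq_polygon (K : Set (ℝ × ℝ)) (θ : ℕ → ℝ) (n : ℕ) :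
    circumscribed K θ n =
      polygon (sortedAngles θ n) (fun i => supportFun K (sortedAngles θ n i)) := by
  ext x
  simp only [circumscribed, polygon, mem_ofPred_eq, sortedAngles, Function.comp_apply]
  rw [(Tuple.sort fun i : Fin n => θ i).forall_congr_left]
  simp [Fin.forall_iff]

theorem subset_circumscribed {K : Set (ℝ × ℝ)} (hK : IsCompact K) (θ : ℕ → ℝ) (n : ℕ) :
    K ⊆ circumscribed K θ n :=
  fun _ hx _ _ => innerDir_le_supportFun hK _ hx

theorem measurableSet_circumscribed (K : Set (ℝ × ℝ)) (θ : ℕ → ℝ) (n : ℕ) :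
    MeasurableSet (circumscribed K θ n) := by
  rw [circumscribed_eq_polygon]
  exact (isClosed_polygon _ _).measurableSet

theorem circumscribed_antitone (K : Set (ℝ × ℝ)) (θ : ℕ → ℝ) : Antitone (circumscribed K θ) :=
  fun _ _ hmn _ hx i hi => hx i (hi.trans_le hmn)

theorem circumscribed_subset_unitSquare {K : Set (ℝ × ℝ)} (hne : K.Nonempty)
    (hKs : K ⊆ unitSquare) {θ : ℕ → ℝ} (h0 : θ 0 = 0) (h1 : θ 1 = Real.pi / 2)
    (h2 : θ 2 = Real.pi) (h3 : θ 3 = 3 * Real.pi / 2) {n : ℕ} (hn : 4 ≤ n) :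
    circumscribed K θ n ⊆ unitSquare := by
  intro x hx
  have hc : Real.cos (3 * Real.pi / 2) = 0 := by
    rw [show 3 * Real.pi / 2 = Real.pi / 2 + Real.pi by ring, Real.cos_add_pi, Real.cos_pi_div_two,
      neg_zero]
  have hs : Real.sin (3 * Real.pi / 2) = -1 := by
    rw [show 3 * Real.pi / 2 = Real.pi / 2 + Real.pi by ring, Real.sin_add_pi, Real.sin_pi_div_two]
  have a0 : innerDir (θ 0) x ≤ 1 := (hx 0 (by omega)).trans <| supportFun_le hne fun y hy => by
    simpa [h0, innerDir] using (hKs hy).1.2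
  have a1 : innerDir (θ 1) x ≤ 1 := (hx 1 (by omega)).trans <| supportFun_le hne fun y hy => by
    simpa [h1, innerDir] using (hKs hy).2.2
  have a2 : innerDir (θ 2) x ≤ 0 := (hx 2 (by omega)).trans <| supportFun_le hne fun y hy => by
    simpa [h2, innerDir] using (hKs hy).1.1
  have a3 : innerDir (θ 3) x ≤ 0 := (hx 3 (by omega)).trans <| supportFun_le hne fun y hy => by
    simpa [h3, innerDir, hc, hs] using (hKs hy).2.1
  simp only [h0, h1, h2, h3, innerDir, hc, hs, Real.cos_zero, Real.sin_zero, Real.cos_pi,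
    Real.sin_pi, Real.cos_pi_div_two, Real.sin_pi_div_two] at a0 a1 a2 a3
  exact ⟨⟨by linarith, by linarith⟩, ⟨by linarith, by linarith⟩⟩

/-- Consistency holds because the polygon contains `K`: any upper bound over the polygon also bounds
`K`, hence dominates its support function. -/
theorem circumscribed_mem_polygonClass {K : Set (ℝ × ℝ)} (hK : IsCompact K) (hne : K.Nonempty)
    {θ : ℕ → ℝ} {n : ℕ} (hs : circumscribed K θ n ⊆ unitSquare) :
    circumscribed K θ n ∈ polygonClass (sortedAngles θ n) := by
  refine ⟨_, fun i => ⟨?_, fun c hc => ?_⟩, circumscribed_eq_polygon K θ n, hs⟩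
  · rintro _ ⟨x, hx, rfl⟩
    exact hx i
  · refine supportFun_le hne fun x hx => hc (mem_image_of_mem _ ?_)
    rw [← circumscribed_eq_polygon]
    exact subset_circumscribed hK θ n hx

/-- Polar form of the coefficient vector of `f`, read as a complex number, with the argument reduced
modulo `2π`. -/
theorem exists_eq_mul_innerDir (f : StrongDual ℝ (ℝ × ℝ)) :
    ∃ r ≥ 0, ∃ t ∈ Ico (0 : ℝ) (2 * Real.pi), ∀ x, f x = r * innerDir t x := by
  set z : ℂ := ⟨f (1, 0), f (0, 1)⟩
  have hper : ∀ t : ℝ, ∃ s ∈ Ico (0 : ℝ) (2 * Real.pi), Real.cos s = Real.cos t ∧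
      Real.sin s = Real.sin t := fun t => by
    refine ⟨toIcoMod Real.two_pi_pos 0 t, by simpa using toIcoMod_mem_Ico Real.two_pi_pos 0 t, ?_⟩
    rw [toIcoMod, zsmul_eq_mul]
    exact ⟨Real.cos_sub_int_mul_two_pi _ _, Real.sin_sub_int_mul_two_pi _ _⟩
  obtain ⟨t, ht, hcos, hsin⟩ := hper z.arg
  refine ⟨‖z‖, norm_nonneg z, t, ht, fun x => ?_⟩
  have hre : ‖z‖ * Real.cos z.arg = f (1, 0) := Complex.norm_mul_cos_arg z
  have him : ‖z‖ * Real.sin z.arg = f (0, 1) := Complex.norm_mul_sin_arg z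
  have hx : x = x.1 • ((1, 0) : ℝ × ℝ) + x.2 • ((0, 1) : ℝ × ℝ) := by ext <;> simp
  rw [innerDir, hcos, hsin]
  conv_lhs => rw [hx, map_add, map_smul, map_smul, ← hre, ← him]
  simp only [smul_eq_mul]
  ring

theorem continuous_supportFun {K : Set (ℝ × ℝ)} (hK : IsCompact K) :
    Continuous (supportFun K) := by
  refine hK.continuous_sSup (f := innerDir) ?_
  unfold innerDir
  fun_prop

/-- Strict separation of a point from `K` is an open condition on the direction, so some `θ i`
already separates. -/
theorem iInter_circumscribed {K : Set (ℝ × ℝ)} (hK : IsCompact K) (hconv : Convex ℝ K)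
    (hne : K.Nonempty) {θ : ℕ → ℝ}
    (hθ : Ico (0 : ℝ) (2 * Real.pi) ⊆ closure (range θ)) :
    ⋂ n, circumscribed K θ n = K := by
  refine Subset.antisymm (fun x hx => ?_) (subset_iInter fun n => subset_circumscribed hK θ n)
  by_contra hxK
  obtain ⟨f, u, hfu, hux⟩ := geometric_hahn_banach_closed_point hconv hK.isClosed hxK
  obtain ⟨r, hr, t, ht, hf⟩ := exists_eq_mul_innerDir f
  have hr0 : r ≠ 0 := by
    rintro rfl
    obtain ⟨y, hy⟩ := hne
    have := (hfu y hy).trans hux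
    simp [hf] at this
  have hr : 0 < r := lt_of_le_of_ne hr hr0.symm
  have hlt : supportFun K t < innerDir t x := by
    refine lt_of_le_of_lt (supportFun_le (c := u / r) hne fun y hy => ?_) ?_
    · rw [le_div_iff₀ hr, mul_comm, ← hf]
      exact (hfu y hy).le
    · rwa [div_lt_iff₀ hr, mul_comm, ← hf]
  have hopen : IsOpen {s | supportFun K s < innerDir s x} :=
    isOpen_lt (continuous_supportFun hK) (by simp only [innerDir]; fun_prop)
  obtain ⟨_, hs, i, rfl⟩ := mem_closure_iff.1 (hθ ht) _ hopen hlt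
  -- The constraint with index `i` first appears at stage `i + 1`.
  exact absurd (mem_iInter.1 hx (i + 1) i i.lt_succ_self) (not_le.2 hs)

theorem tendsto_nikodymDist_circumscribed {K : Set (ℝ × ℝ)} (hK : IsCompact K)
    (hconv : Convex ℝ K) (hne : K.Nonempty) {θ : ℕ → ℝ}
    (hθ : Ico (0 : ℝ) (2 * Real.pi) ⊆ closure (range θ))
    {m : ℕ} (hs : circumscribed K θ m ⊆ unitSquare) :
    Tendsto (fun n => nikodymDist K (circumscribed K θ n)) atTop (𝓝 0) := by
  have hsymm : ∀ n, K ∆ circumscribed K θ n = circumscribed K θ n \ K := fun n =>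
    symmDiff_of_le (subset_circumscribed hK θ n)
  have h := tendsto_measure_iInter_atTop (μ := volume) (s := fun n => circumscribed K θ n \ K)
    (fun n => ((measurableSet_circumscribed K θ n).diff hK.measurableSet).nullMeasurableSet)
    (fun i j hij => sdiff_subset_sdiff_left (circumscribed_antitone K θ hij))
    ⟨m, ne_top_of_le_ne_top volume_unitSquare_ne_top (measure_mono (sdiff_subset.trans hs))⟩
  have hempty : ⋂ n, circumscribed K θ n \ K = ∅ := by
    refine eq_empty_of_forall_notMem fun x hx => ?_
    have hx := mem_iInter.1 hx
    exact (hx 0).2 ((iInter_circumscribed hK hconv hne hθ).subset (mem_iInter.2 fun n => (hx n).1))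
  rw [hempty, measure_empty] at h
  simp only [nikodymDist, hsymm, Measure.real]
  exact (ENNReal.tendsto_toReal ENNReal.zero_ne_top).comp h

/-! ### Polynomial approximation and control by moments -/

theorem eval_fst_mul_eval_snd_mem_span {p q : ℝ[X]} (hp : p ∈ Submodule.span ℝ (range legendrePoly))
    (hq : q ∈ Submodule.span ℝ (range legendrePoly)) :
    (fun x : ℝ × ℝ => p.eval x.1 * q.eval x.2) ∈ Submodule.span ℝ (range legendreFun) := by
  induction hp, hq using Submodule.span_induction₂ with
  | mem_mem p q hp hq =>
    obtain ⟨k, rfl⟩ := hp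
    obtain ⟨l, rfl⟩ := hq
    exact Submodule.subset_span ⟨(k, l), rfl⟩
  | zero_left q hq =>
    convert zero_mem (Submodule.span ℝ (range legendreFun)) using 1
    ext x; simp
  | zero_right q hq =>
    convert zero_mem (Submodule.span ℝ (range legendreFun)) using 1
    ext x; simp
  | add_left p p' q _ _ _ h h' =>
    convert add_mem h h' using 1
    ext x; simp [add_mul]
  | add_right p q q' _ _ _ h h' =>
    convert add_mem h h' using 1
    ext x; simp [mul_add]
  | smul_left r p q _ _ h =>
    convert Submodule.smul_mem _ r h using 1
    ext x; simp [mul_assoc]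
  | smul_right r p q _ _ h =>
    convert Submodule.smul_mem _ r h using 1
    ext x; simp [mul_left_comm]

/-- Finite linear combinations of the tensor product Legendre functions are uniformly dense in the
continuous functions on the unit square. -/
theorem exists_mem_span_legendreFun_near {f : ℝ × ℝ → ℝ} (hf : Continuous f) {ε : ℝ}
    (hε : 0 < ε) :
    ∃ q ∈ Submodule.span ℝ (range legendreFun), ∀ x ∈ unitSquare, |q x - f x| < ε := by
  let a : C(ℝ × ℝ, ℝ) := ⟨Prod.fst, continuous_fst⟩
  let b : C(ℝ × ℝ, ℝ) := ⟨Prod.snd, continuous_snd⟩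
  have hsep : (Algebra.adjoin ℝ {a, b}).SeparatesPoints := by
    intro x y hxy
    by_cases h : x.1 = y.1
    · exact ⟨b, ⟨b, Algebra.subset_adjoin (by simp), rfl⟩, fun h' => hxy (Prod.ext h h')⟩
    · exact ⟨a, ⟨a, Algebra.subset_adjoin (by simp), rfl⟩, h⟩
  obtain ⟨g, hg, hgf⟩ :=
    ContinuousMap.exists_mem_subalgebra_near_continuous_of_isCompact_of_separatesPoints hsep
      ⟨f, hf⟩ isCompact_unitSquare hε
  refine ⟨g, ?_, hgf⟩
  clear hgf
  -- The algebra generated by the coordinates is spanned by the monomials `a ^ m * b ^ n`.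
  rw [← Subalgebra.mem_toSubmodule, Algebra.adjoin_eq_span] at hg
  induction hg using Submodule.span_induction with
  | mem g hg =>
    obtain ⟨m, n, rfl⟩ := (Submonoid.mem_closure_pair a b g).1 hg
    convert eval_fst_mul_eval_snd_mem_span (X_pow_mem_span_legendrePoly m)
      (X_pow_mem_span_legendrePoly n) using 1
    ext x; simp [a, b]
  | zero => exact zero_mem _
  | add g g' _ _ h h' => exact add_mem h h'
  | smul r g _ h => exact Submodule.smul_mem _ r h

theorem continuous_of_mem_span_legendreFun {q : ℝ × ℝ → ℝ}
    (hq : q ∈ Submodule.span ℝ (range legendreFun)) : Continuous q := by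
  induction hq using Submodule.span_induction with
  | mem q hq =>
    obtain ⟨i, rfl⟩ := hq
    exact continuous_legendreFun i
  | zero => exact continuous_zero
  | add q q' _ _ h h' => exact h.add h'
  | smul r q _ h => exact h.const_smul r

theorem integrableOn_of_mem_span_legendreFun {q : ℝ × ℝ → ℝ}
    (hq : q ∈ Submodule.span ℝ (range legendreFun)) : IntegrableOn q unitSquare :=
  (continuous_of_mem_span_legendreFun hq).continuousOn.integrableOn_compact isCompact_unitSquare

/-- Integrals against a fixed polynomial are controlled by the Legendre discrepancy. -/
theorem exists_abs_integral_indicatorDiff_mul_le {q : ℝ × ℝ → ℝ}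
    (hq : q ∈ Submodule.span ℝ (range legendreFun)) :
    ∃ C ≥ 0, ∃ M : ℕ, ∀ N ≥ M, ∀ K P : Set (ℝ × ℝ), MeasurableSet K → MeasurableSet P →
      K ⊆ unitSquare → P ⊆ unitSquare →
      |∫ x in unitSquare, indicatorDiff K P x * q x| ≤
        C * Real.sqrt (legendreDiscrepancy N K P) := by
  induction hq using Submodule.span_induction with
  | mem q hq =>
    obtain ⟨i, rfl⟩ := hq
    refine ⟨1, zero_le_one, max i.1 i.2, fun N hN K P hK hP hKs hPs => ?_⟩
    rw [← legendreMoment_sub hK hP hKs hPs, one_mul]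
    exact abs_legendreMoment_sub_le ((le_max_left _ _).trans hN) ((le_max_right _ _).trans hN) K P
  | zero => exact ⟨0, le_rfl, 0, fun N _ K P _ _ _ _ => by simp⟩
  | add q q' hq hq' h h' =>
    obtain ⟨C, hC, M, h⟩ := h
    obtain ⟨C', hC', M', h'⟩ := h'
    refine ⟨C + C', add_nonneg hC hC', max M M', fun N hN K P hK hP hKs hPs => ?_⟩
    simp only [Pi.add_apply, mul_add]
    rw [integral_add
      (integrableOn_indicatorDiff_mul hK hP (integrableOn_of_mem_span_legendreFun hq))
      (integrableOn_indicatorDiff_mul hK hP (integrableOn_of_mem_span_legendreFun hq')), add_mul]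
    exact (abs_add_le _ _).trans
      (add_le_add (h N ((le_max_left _ _).trans hN) K P hK hP hKs hPs)
        (h' N ((le_max_right _ _).trans hN) K P hK hP hKs hPs))
  | smul r q hq h =>
    obtain ⟨C, hC, M, h⟩ := h
    refine ⟨|r| * C, by positivity, M, fun N hN K P hK hP hKs hPs => ?_⟩
    simp only [Pi.smul_apply, smul_eq_mul, mul_left_comm _ r]
    rw [integral_const_mul, abs_mul, mul_assoc]
    exact mul_le_mul_of_nonneg_left (h N hN K P hK hP hKs hPs) (abs_nonneg r)

/-- Passes through a continuous function; the uniform error becomes an `L¹` error since the square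
has area 1. -/
theorem exists_mem_span_integral_abs_sub_le {g : ℝ × ℝ → ℝ} (hg : IntegrableOn g unitSquare)
    {ε : ℝ} (hε : 0 < ε) :
    ∃ q ∈ Submodule.span ℝ (range legendreFun), ∫ x in unitSquare, |g x - q x| ≤ ε := by
  obtain ⟨f, hgf, hfi⟩ := hg.exists_boundedContinuous_integral_sub_le (half_pos hε)
  obtain ⟨q, hq, hqf⟩ := exists_mem_span_legendreFun_near f.continuous (half_pos hε)
  refine ⟨q, hq, ?_⟩
  have hqi := integrableOn_of_mem_span_legendreFun hq
  have hvol : volume.real unitSquare = 1 := by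
    rw [Measure.real, unitSquare, Measure.volume_eq_prod, Measure.prod_prod]
    simp
  have h2 : ∫ x in unitSquare, |f x - q x| ≤ ε / 2 := by
    have := setIntegral_mono_on (g := fun _ => ε / 2) (hfi.sub hqi).abs
      (continuousOn_const.integrableOn_compact isCompact_unitSquare) measurableSet_unitSquare
      fun x hx => by
        rw [Pi.sub_apply, abs_sub_comm]
        exact (hqf x hx).le
    simpa [hvol] using this
  calc ∫ x in unitSquare, |g x - q x|
      ≤ ∫ x in unitSquare, (|g x - f x| + |f x - q x|) :=
        integral_mono (hg.sub hqi).abs ((hg.sub hfi).abs.add (hfi.sub hqi).abs)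
          fun x => abs_sub_le _ _ _
    _ = (∫ x in unitSquare, |g x - f x|) + ∫ x in unitSquare, |f x - q x| :=
        integral_add (hg.sub hfi).abs (hfi.sub hqi).abs
    _ ≤ ε := by
        have : ∫ x in unitSquare, |g x - f x| ≤ ε / 2 := hgf
        linarith

/-- Sets whose Legendre moments of all orders approach those of a measurable set `K` converge to
`K` in the Nikodym distance. -/
theorem exists_nikodymDist_lt {K : Set (ℝ × ℝ)} (hK : MeasurableSet K) (hKs : K ⊆ unitSquare)
    {ε : ℝ} (hε : 0 < ε) :
    ∃ δ > 0, ∃ M : ℕ, ∀ N ≥ M, ∀ P : Set (ℝ × ℝ), MeasurableSet P → P ⊆ unitSquare →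
      legendreDiscrepancy N K P < δ → nikodymDist K P < ε := by
  have hone : IntegrableOn (fun _ => (1 : ℝ)) unitSquare :=
    continuousOn_const.integrableOn_compact isCompact_unitSquare
  have hg : IntegrableOn (fun x => 2 * K.indicator (fun _ => (1 : ℝ)) x - 1) unitSquare :=
    ((hone.indicator hK).const_mul 2).sub hone
  obtain ⟨q, hq, hgq⟩ := exists_mem_span_integral_abs_sub_le hg (half_pos hε)
  obtain ⟨C, hC, M, hM⟩ := exists_abs_integral_indicatorDiff_mul_le hq
  have hqi := integrableOn_of_mem_span_legendreFun hq
  -- Chosen so that `C * √discrepancy < ε / 2`; `C + 1` covers the case `C = 0`.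
  refine ⟨(ε / 2 / (C + 1)) ^ 2, by positivity, M, fun N hN P hP hPs hlt => ?_⟩
  have hsplit : nikodymDist K P =
      (∫ x in unitSquare, indicatorDiff K P x *
        (2 * K.indicator (fun _ => (1 : ℝ)) x - 1 - q x)) +
      ∫ x in unitSquare, indicatorDiff K P x * q x := by
    rw [← integral_indicatorDiff_sq hK hP hKs hPs,
      ← integral_add (by exact integrableOn_indicatorDiff_mul hK hP (hg.sub hqi))
        (integrableOn_indicatorDiff_mul hK hP hqi)]
    congr 1
    -- Pointwise, with `d = 1_K - 1_P`, this is `d² = d (2·1_K - 1)`: `d` is nonnegative on `K` and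
    -- nonpositive off `K`.
    ext x
    by_cases h1 : x ∈ K <;> by_cases h2 : x ∈ P <;> simp [indicatorDiff, h1, h2]
    norm_num
  have h1 : ∫ x in unitSquare, indicatorDiff K P x *
      (2 * K.indicator (fun _ => (1 : ℝ)) x - 1 - q x) ≤ ε / 2 := by
    refine (integral_mono (integrableOn_indicatorDiff_mul hK hP (hg.sub hqi)) (hg.sub hqi).abs
      fun x => ?_).trans hgq
    refine (le_abs_self _).trans ?_
    rw [abs_mul]
    exact mul_le_of_le_one_left (abs_nonneg _) (abs_indicatorDiff_le_one K P x)
  have h2 := (le_abs_self _).trans (hM N hN K P hK hP hKs hPs)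
  have h3 : Real.sqrt (legendreDiscrepancy N K P) < ε / 2 / (C + 1) :=
    (Real.sqrt_lt' (by positivity)).2 hlt
  have h4 : C * Real.sqrt (legendreDiscrepancy N K P) < ε / 2 := by
    rw [lt_div_iff₀ (by positivity)] at h3
    nlinarith [Real.sqrt_nonneg (legendreDiscrepancy N K P), hC, h3]
  linarith

end MomentReconstruction

/-! ### Consistency of the least squares estimator -/

open MomentReconstruction

theorem mainTheorem8 (K : Set (ℝ × ℝ)) (hK : MomentReconstruction.IsConvexBody K)
    (hKsq : K ⊆ MomentReconstruction.unitSquare)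
    (θ : ℕ → ℝ) (hθ_mem : ∀ i, θ i ∈ Ico (0 : ℝ) (2 * Real.pi))
    (hθ_dense : Ico (0 : ℝ) (2 * Real.pi) ⊆ closure (range θ))
    (hθ_inj : ∀ i j, i ≠ j → θ i ≠ θ j)
    (hθ0 : θ 0 = 0) (hθ1 : θ 1 = Real.pi / 2)
    (hθ2 : θ 2 = Real.pi) (hθ3 : θ 3 = 3 * Real.pi / 2)
    (P : ℕ → ℕ → Set (ℝ × ℝ))
    (hP : ∀ n N : ℕ, 4 ≤ n → 1 ≤ N →
      MomentReconstruction.IsLeastSquaresEstimator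
        (MomentReconstruction.sortedAngles θ n) N K (P n N)) :
    Tendsto (fun p : ℕ × ℕ => MomentReconstruction.nikodymDist K (P p.1 p.2))
      (atTop ×ˢ atTop) (𝓝 0) := by
  have hne : K.Nonempty := hK.interior_nonempty.mono interior_subset
  have hKm : MeasurableSet K := hK.isCompact.measurableSet
  have hs : ∀ n, 4 ≤ n → circumscribed K θ n ⊆ unitSquare := fun n hn =>
    circumscribed_subset_unitSquare hne hKsq hθ0 hθ1 hθ2 hθ3 hn
  have hlim := tendsto_nikodymDist_circumscribed hK.isCompact hK.convex hne hθ_dense (hs 4 le_rfl)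
  rw [Metric.tendsto_nhds]
  intro ε hε
  obtain ⟨δ, hδ, M, hM⟩ := exists_nikodymDist_lt hKm hKsq hε
  have hn : ∀ᶠ n in atTop, 4 ≤ n ∧ nikodymDist K (circumscribed K θ n) < δ :=
    (eventually_ge_atTop 4).and (hlim.eventually_lt_const hδ)
  filter_upwards [hn.prod_mk ((eventually_ge_atTop 1).and (eventually_ge_atTop M))]
  rintro ⟨n, N⟩ ⟨⟨hn, hnδ⟩, hN, hNM⟩
  obtain ⟨hmem, hmin⟩ := hP n N hn hN
  obtain ⟨h, -, hpoly, hPs⟩ := hmem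
  have hPm : MeasurableSet (P n N) := by
    rw [hpoly]
    exact (isClosed_polygon _ _).measurableSet
  -- Minimality against the circumscribed polygon, then Bessel; the bound on `n` does not depend on
  -- `N`.
  have hdisc : legendreDiscrepancy N K (P n N) < δ :=
    ((isMinOn_iff.1 hmin _ (circumscribed_mem_polygonClass hK.isCompact hne (hs n hn))).trans
      (legendreDiscrepancy_le_nikodymDist hKm (measurableSet_circumscribed K θ n) hKsq
        (hs n hn) N)).trans_lt hnδ
  rw [Real.dist_0_eq_abs, abs_of_nonneg (show 0 ≤ nikodymDist K (P n N) from measureReal_nonneg)]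
  exact hM N hNM (P n N) hPm hPs hdisc
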